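/- Let $L$ be a finite relational first-order language with relation symbols $R_0,\dots,R_{p-1}$, at least one of which has arity $\ge 2$, and let $0<\alpha_i\le 1$ be real numbers for $i<p$. Consider only $L$-structures in which every $R_i$ is symmetric (invariant under permutations of its arguments) and irreflexive (holding only of sequences of distinct elements), so that the relations are relations on sets. For a finite such structure $A$ put $\delta_\alpha(A)=|A|-\sum_{i<p}\alpha_i w_i(A)$, where $w_i(A)$ is the number of subsets of $A$ on which $R_i$ holds, and let $\mathbf K_\alpha$ be the class of finite structures $A$ with $\delta_\alpha(A')\ge 0$ for every substructure $A'\subseteq A$. For a structure $N$ all of whose finite substructures are in $\mathbf K_\alpha$ and finite $X\subseteq N$ let $d_N(X)=\inf\{\delta_\alpha(B): X\subseteq B\subseteq N,\ B \text{ finite}\}$; write $M\le_s N$ if $M\subseteq N$ and $d_M(X)=d_N(X)$ for every finite $X\subseteq M$. A countable structure $M$ all of whose finite substructures are in $\mathbf K_\alpha$ is called generic if (i) whenever $A\le_s M$ and $A\le_s B$ with $A,B\in\mathbf K_\alpha$, there is $B'\le_s M$ isomorphic to $B$ over $A$; and (ii) $M$ is the union of a chain $A_0\le_s A_1\le_s\cdots$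 of members of $\mathbf K_\alpha$. Let $T_\alpha$ be the theory of the generic structures, i.e. the set of $L$-sentences true in every generic structure (a generic structure exists and is unique up to isomorphism). Then $T_\alpha$ is not model complete: there are models $M$, $N$ of $T_\alpha$ and an embedding $M\to N$ that is not elementary. -/

import Mathlib

namespace KAlpha

open scoped FirstOrder

section Dimension

variable {L : FirstOrder.Language.{0, 0}}

/-- The relations of the structure are symmetric and hold only of sequences of distinct elements,
so that they are relations on finite sets. -/
def SymmIrrefl (L : FirstOrder.Language.{0, 0}) (M : Type) [L.Structure M] : Prop :=
  ∀ (n : ℕ) (R : L.Relations n) (x : Fin n → M), FirstOrder.Language.Structure.RelMap R x →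
    Function.Injective x ∧ ∀ σ : Equiv.Perm (Fin n), FirstOrder.Language.Structure.RelMap R (x ∘ σ)

/-- The realizations of `R` inside the finite set `X`, as sets (not as sequences). -/
def edges {M : Type} [L.Structure M] {n : ℕ} (R : L.Relations n) (X : Finset M) :
    Set (Finset M) :=
  {s | s ⊆ X ∧ ∃ x : Fin n → M,
    FirstOrder.Language.Structure.RelMap R x ∧ Set.range x = (s : Set M)}

variable [Fintype (Σ n, L.Relations n)]

/-- `δ_α` of the structure that `M` induces on the finite set `X`: the number of points minus the
weighted number of edges. -/
noncomputable def delta (α : (Σ n, L.Relations n) → ℝ) {M : Type} [L.Structure M]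
    (X : Finset M) : ℝ :=
  (X.card : ℝ) - ∑ R : (Σ n, L.Relations n), α R * ((edges R.2 X).ncard : ℝ)

/-- `M` is symmetric and irreflexive and all its finite substructures have nonnegative `δ_α`.
The finite structures with this property form the class `K_α` (which is closed under
substructures); for arbitrary `M` the property says that all finite substructures are in `K_α`. -/
def InK (α : (Σ n, L.Relations n) → ℝ) (M : Type) [L.Structure M] : Prop :=
  SymmIrrefl L M ∧ ∀ X : Finset M, 0 ≤ delta α X

/-- `d_M(X)`, the infimum of `δ_α(B)` over the finite `B` with `X ⊆ B ⊆ M`. -/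
noncomputable def dim (α : (Σ n, L.Relations n) → ℝ) {M : Type} [L.Structure M]
    (X : Finset M) : ℝ :=
  ⨅ B : {B : Finset M // X ⊆ B}, delta α B.1

/-- `f : M → N` is a strong embedding: `d_M(X) = d_N(f X)` for all finite `X ⊆ M`. -/
def IsStrong (α : (Σ n, L.Relations n) → ℝ) {M N : Type} [L.Structure M] [L.Structure N]
    (f : M ↪[L] N) : Prop :=
  ∀ X : Finset M, dim α X = dim α (X.map f.toEmbedding)

/-- `M` is a `(K_α, ≤_s)`-generic structure. -/
structure IsGeneric (α : (Σ n, L.Relations n) → ℝ) (M : Type) [L.Structure M] : Prop where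
  countable : Countable M
  inK : InK α M
  /-- If `A ≤_s M` and `A ≤_s B` with `A`, `B` in `K_α`, then `B` has a strong embedding into `M`
  over `A`. -/
  extend : ∀ (A B : Type) [L.Structure A] [L.Structure B] [Finite A] [Finite B],
    InK α A → InK α B → ∀ (f : A ↪[L] M) (g : A ↪[L] B), IsStrong α f → IsStrong α g →
      ∃ h : B ↪[L] M, IsStrong α h ∧ ∀ a, h (g a) = f a
  /-- `M` is the union of a chain `A 0 ≤_s A 1 ≤_s ⋯` of members of `K_α`. -/
  union : ∃ (A : ℕ → L.Substructure M) (hA : ∀ i, A i ≤ A (i + 1)),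
    (∀ i, Finite (A i) ∧ InK α (A i)) ∧
    (∀ i, IsStrong α (FirstOrder.Language.Substructure.inclusion (hA i))) ∧
    ∀ x : M, ∃ i, x ∈ A i

/-- `T_α`, the theory of the `(K_α, ≤_s)`-generic structures. (It would be inconsistent, and hence
trivially model complete, if there were none.) -/
def genericTheory (α : (Σ n, L.Relations n) → ℝ) : L.Theory :=
  {φ | ∀ (M : Type) [L.Structure M], IsGeneric α M → M ⊨ φ}

end Dimension

/-- Model completeness: every embedding between models of `T` is elementary. -/
def IsModelComplete {L : FirstOrder.Language.{0, 0}} (T : L.Theory) : Prop :=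
  ∀ (M N : FirstOrder.Language.Theory.ModelType.{0, 0, 0} T) (f : M ↪[L] N)
    (n : ℕ) (φ : L.Formula (Fin n)) (x : Fin n → M),
    φ.Realize (f ∘ x) ↔ φ.Realize x

end KAlpha

namespace KAlpha

open scoped FirstOrder
open FirstOrder.Language

/-! The generic structure has a self-embedding that is not elementary. Let `R` have arity `l + 2`
and choose `k` with `k * α R > 1`. Consider `k` disjoint blocks of `l + 1` points with no edges
among them, and the existential formula saying that some point `c` (an apex) forms an `R`-edge with
each block.

If the blocks form a strong subset of the generic structure, there is no apex: adding one changes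
the predimension by at most `1 - k * α R < 0` (`not_cone_of_strong_discrete`). But the blocks
together with an apex form a member of the class, because the edges within any vertex set can be
charged to distinct vertices and all weights are at most `1` (`coneState`). So the generic structure
also contains an edgeless copy of the blocks that does have an apex (`exists_embeds_cone`).

It remains to extend the map from the strong copy to the other one to an embedding of the whole
structure. This rests on an asymmetry of free amalgamation (`State.exists_amalgam`): if `a` is
strong in `c`, then `q` is strong in the amalgam of `q` and `c` over `a`, even when `a` is not
strong in `q`. Hence any embedding of a finite `p`, strong or not, extends to each strong extension
of `p` (`Embeds.extend`), and a union over a chain starting with the blocks gives the embedding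
(`Embeds.extend_univ`).

Finite structures are coded as hypergraphs on sets of naturals. A generic structure with prescribed
strong start is built by meeting countably many cofinal sets. -/

/-- A (possible) hyperedge on `V`: a relation symbol together with a finite set. -/
abbrev Edge (L : FirstOrder.Language.{0, 0}) (V : Type) : Type := (Σ n, L.Relations n) × Finset V

/-! ### Predimension of weighted hypergraphs. -/

section Hypergraph

variable {L : FirstOrder.Language.{0, 0}} [Fintype (Σ n, L.Relations n)]

open Classical in
/-- The edges of `E` that lie inside the finite set `X`. -/
noncomputable def edgesIn {V : Type} (E : Set (Edge L V)) (X : Finset V) : Finset (Edge L V) :=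
  (Finset.univ ×ˢ X.powerset).filter (· ∈ E)

/-- The predimension of the finite set `X` in the hypergraph `E`. -/
noncomputable def predim (α : (Σ n, L.Relations n) → ℝ) {V : Type} (E : Set (Edge L V))
    (X : Finset V) : ℝ :=
  (X.card : ℝ) - ∑ e ∈ edgesIn E X, α e.1

@[simp]
theorem mem_edgesIn {V : Type} {E : Set (Edge L V)} {X : Finset V} {e : Edge L V} :
    e ∈ edgesIn E X ↔ e ∈ E ∧ e.2 ⊆ X := by
  simp [edgesIn, and_comm]

variable {α : (Σ n, L.Relations n) → ℝ}

theorem predim_congr {V : Type} {E F : Set (Edge L V)} {X : Finset V}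
    (h : ∀ e : Edge L V, e.2 ⊆ X → (e ∈ E ↔ e ∈ F)) : predim α E X = predim α F X := by
  have : edgesIn E X = edgesIn F X := by
    ext e
    simp only [mem_edgesIn]
    exact ⟨fun ⟨h1, h2⟩ => ⟨(h e h2).1 h1, h2⟩, fun ⟨h1, h2⟩ => ⟨(h e h2).2 h1, h2⟩⟩
  rw [predim, predim, this]

theorem predim_map {V W : Type} (j : V ↪ W) {E : Set (Edge L V)} {F : Set (Edge L W)}
    {X : Finset V}
    (h : ∀ R s, s ⊆ X → ((R, s.map j) ∈ F ↔ (R, s) ∈ E)) :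
    predim α F (X.map j) = predim α E X := by
  have : edgesIn F (X.map j) =
      (edgesIn E X).map
        ((Function.Embedding.refl _).prodMap (Finset.mapEmbedding j).toEmbedding) := by
    ext ⟨R, s⟩
    simp only [mem_edgesIn, Finset.mem_map, Prod.exists, Function.Embedding.coe_prodMap,
      Prod.map_apply, Prod.mk.injEq, Function.Embedding.refl_apply]
    constructor
    · rintro ⟨h1, h2⟩
      obtain ⟨t, ht, rfl⟩ := Finset.subset_map_iff.1 h2
      exact ⟨R, t, ⟨(h R t ht).1 h1, ht⟩, rfl, rfl⟩
    · rintro ⟨R', t, ⟨h1, h2⟩, rfl, rfl⟩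
      exact ⟨(h R' t h2).2 h1, Finset.map_subset_map.2 h2⟩
  rw [predim, predim, this, Finset.sum_map, Finset.card_map]
  rfl

/-- Cardinality is modular, and the only edges not balanced are those inside the union that lie in
neither set; they lower the left side. -/
theorem predim_submodular (hα : ∀ R, 0 ≤ α R) {V : Type} [DecidableEq V] (E : Set (Edge L V))
    (X Y : Finset V) :
    predim α E (X ∪ Y) + predim α E (X ∩ Y) ≤ predim α E X + predim α E Y := by
  classical
  have hc : ((X ∪ Y).card : ℝ) + (X ∩ Y).card = X.card + Y.card := by
    exact_mod_cast Finset.card_union_add_card_inter X Y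
  have hs := Finset.sum_union_inter (s₁ := edgesIn E X) (s₂ := edgesIn E Y) (f := fun e => α e.1)
  have hi : edgesIn E X ∩ edgesIn E Y = edgesIn E (X ∩ Y) := by
    ext e
    simp only [Finset.mem_inter, mem_edgesIn, Finset.subset_inter_iff]
    tauto
  have hu : ∑ e ∈ edgesIn E X ∪ edgesIn E Y, α e.1 ≤ ∑ e ∈ edgesIn E (X ∪ Y), α e.1 := by
    refine Finset.sum_le_sum_of_subset_of_nonneg (fun e he => ?_) fun e _ _ => hα _
    simp only [Finset.mem_union, mem_edgesIn] at he ⊢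
    rcases he with ⟨h1, h2⟩ | ⟨h1, h2⟩
    · exact ⟨h1, h2.trans Finset.subset_union_left⟩
    · exact ⟨h1, h2.trans Finset.subset_union_right⟩
  rw [hi] at hs
  simp only [predim]
  linarith

/-- In the free amalgam of `Q` (on `U`) and `W` (on `V`), the predimension of a set is determined
by its traces on `U`, on `V`, and on `U ∩ V`. -/
theorem predim_union {V : Type} [DecidableEq V] {Q W : Set (Edge L V)} {U T X : Finset V}
    (hQ : ∀ e ∈ Q, e.2 ⊆ U) (hW : ∀ e ∈ W, e.2 ⊆ T)
    (h : ∀ e : Edge L V, e.2 ⊆ U ∩ T → (e ∈ Q ↔ e ∈ W)) (hX : X ⊆ U ∪ T) :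
    predim α (Q ∪ W) X + predim α W (X ∩ (U ∩ T)) =
      predim α Q (X ∩ U) + predim α W (X ∩ T) := by
  classical
  have hc : (X.card : ℝ) + (X ∩ (U ∩ T)).card = (X ∩ U).card + (X ∩ T).card := by
    have := Finset.card_union_add_card_inter (X ∩ U) (X ∩ T)
    rw [← Finset.inter_union_distrib_left, Finset.inter_eq_left.2 hX,
      ← Finset.inter_inter_distrib_left] at this
    exact_mod_cast this
  have hs := Finset.sum_union_inter (s₁ := edgesIn Q (X ∩ U)) (s₂ := edgesIn W (X ∩ T))
    (f := fun e => α e.1)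
  have hi : edgesIn Q (X ∩ U) ∩ edgesIn W (X ∩ T) = edgesIn W (X ∩ (U ∩ T)) := by
    ext e
    simp only [Finset.mem_inter, mem_edgesIn, Finset.subset_inter_iff]
    have := h e
    simp only [Finset.subset_inter_iff] at this
    tauto
  have hu : edgesIn Q (X ∩ U) ∪ edgesIn W (X ∩ T) = edgesIn (Q ∪ W) X := by
    ext e
    simp only [Finset.mem_union, mem_edgesIn, Finset.subset_inter_iff, Set.mem_union]
    have := hQ e
    have := hW e
    tauto
  rw [hi, hu] at hs
  simp only [predim]
  linarith

end Hypergraph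

/-! ### Relational structures as hypergraphs; strong embeddings. -/

section Structures

variable {L : FirstOrder.Language.{0, 0}}

/-- The hypergraph of realizations of the relations of a structure. -/
def edgeSet (L : FirstOrder.Language.{0, 0}) (M : Type) [L.Structure M] : Set (Edge L M) :=
  {e | ∃ x : Fin e.1.1 → M, Structure.RelMap e.1.2 x ∧ Set.range x = (e.2 : Set M)}

theorem delta_eq_predim [Fintype (Σ n, L.Relations n)] (α : (Σ n, L.Relations n) → ℝ) {M : Type}
    [L.Structure M] (X : Finset M) : delta α X = predim α (edgeSet L M) X := by
  classical
  rw [delta, predim, edgesIn, Finset.sum_filter, Finset.sum_product]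
  congr 1
  refine Finset.sum_congr rfl fun R _ => ?_
  have : edges R.2 X = ↑(X.powerset.filter fun s => (R, s) ∈ edgeSet L M) := by
    ext s
    rw [Finset.mem_coe, Finset.mem_filter, Finset.mem_powerset]
    rfl
  rw [this, Set.ncard_coe_finset, ← Finset.sum_filter]
  simp only
  rw [Finset.sum_const, nsmul_eq_mul, mul_comm]

/-- Two injective enumerations of the same set differ by a permutation, so symmetry makes the
relation depend on the set alone. -/
theorem relMap_iff_mem_edgeSet {M : Type} [L.Structure M] [DecidableEq M] (h : SymmIrrefl L M)
    {n : ℕ} (R : L.Relations n) (x : Fin n → M) :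
    Structure.RelMap R x ↔
      Function.Injective x ∧ ((⟨n, R⟩, Finset.univ.image x) : Edge L M) ∈ edgeSet L M := by
  constructor
  · intro hx
    exact ⟨(h n R x hx).1, x, hx, by simp⟩
  · rintro ⟨hx, y, hy, hxy⟩
    have hr : Set.range x = Set.range y := by simpa using hxy.symm
    obtain ⟨hyi, hp⟩ := h n R y hy
    let σ : Equiv.Perm (Fin n) :=
      (Equiv.ofInjective x hx).trans ((Equiv.setCongr hr).trans (Equiv.ofInjective y hyi).symm)
    have : y ∘ σ = x := by
      funext i
      simp [σ, Equiv.apply_ofInjective_symm]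
    rw [← this]
    exact hp σ

theorem mem_edgeSet_map_iff {M N : Type} [L.Structure M] [L.Structure N] (f : M ↪[L] N)
    (R : Σ n, L.Relations n) (s : Finset M) :
    (R, s.map f.toEmbedding) ∈ edgeSet L N ↔ (R, s) ∈ edgeSet L M := by
  constructor
  · rintro ⟨x, hx, hxs⟩
    have : ∀ i, ∃ a, f a = x i := fun i => by
      have : x i ∈ ((s.map f.toEmbedding : Finset N) : Set N) := hxs ▸ ⟨i, rfl⟩
      simp only [Finset.coe_map, Set.mem_image] at this
      obtain ⟨a, _, ha⟩ := this
      exact ⟨a, ha⟩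
    choose y hy using this
    obtain rfl : f ∘ y = x := funext hy
    refine ⟨y, (f.map_rel R.2 y).1 hx, ?_⟩
    have h2 : f '' Set.range y = f '' (s : Set M) := by
      rw [← Set.range_comp, hxs, Finset.coe_map]; rfl
    exact f.injective.image_injective h2
  · rintro ⟨x, hx, hxs⟩
    refine ⟨f ∘ x, (f.map_rel R.2 x).2 hx, ?_⟩
    rw [Set.range_comp, hxs, Finset.coe_map]
    rfl

theorem SymmIrrefl.of_embedding {M N : Type} [L.Structure M] [L.Structure N] (f : M ↪[L] N)
    (h : SymmIrrefl L N) : SymmIrrefl L M := fun n R x hx => by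
  obtain ⟨h1, h2⟩ := h n R (f ∘ x) ((f.map_rel R x).2 hx)
  exact ⟨h1.of_comp, fun σ => (f.map_rel R (x ∘ σ)).1 (h2 σ)⟩

/-- An injection that matches the edges is an embedding of relational structures. -/
def embeddingOfEdges [L.IsRelational] {M N : Type} [L.Structure M] [L.Structure N]
    (hM : SymmIrrefl L M) (hN : SymmIrrefl L N) (j : M ↪ N)
    (h : ∀ R s, (R, s.map j) ∈ edgeSet L N ↔ (R, s) ∈ edgeSet L M) : M ↪[L] N where
  toEmbedding := j
  map_fun' f := isEmptyElim f
  map_rel' {n} R x := by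
    classical
    rw [relMap_iff_mem_edgeSet hM, relMap_iff_mem_edgeSet hN, ← h, Finset.map_eq_image,
      Finset.image_image]
    exact and_congr_left' (j.injective.of_comp_iff x)

variable [Fintype (Σ n, L.Relations n)] {α : (Σ n, L.Relations n) → ℝ}

theorem delta_map {M N : Type} [L.Structure M] [L.Structure N] (f : M ↪[L] N) (X : Finset M) :
    delta α (X.map f.toEmbedding) = delta α X := by
  rw [delta_eq_predim, delta_eq_predim]
  exact predim_map _ fun R s _ => mem_edgeSet_map_iff f R s

theorem InK.of_embedding {M N : Type} [L.Structure M] [L.Structure N] (f : M ↪[L] N)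
    (h : InK α N) : InK α M :=
  ⟨h.1.of_embedding f, fun X => delta_map f X ▸ h.2 _⟩

theorem dim_le {M : Type} [L.Structure M] (h : InK α M) {X B : Finset M} (hB : X ⊆ B) :
    dim α X ≤ delta α B :=
  ciInf_le (f := fun B : {B : Finset M // X ⊆ B} => delta α B.1)
    ⟨0, by rintro _ ⟨B, rfl⟩; exact h.2 _⟩ ⟨B, hB⟩

theorem le_dim {M : Type} [L.Structure M] {X : Finset M} {r : ℝ}
    (h : ∀ B, X ⊆ B → r ≤ delta α B) : r ≤ dim α X :=
  haveI : Nonempty {B : Finset M // X ⊆ B} := ⟨⟨X, subset_rfl⟩⟩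
  le_ciInf fun B => h B.1 B.2

/-- The trace of a superset of `f X` competes in the infimum for `X`; the other inequality holds for
every embedding. This and the next lemma translate between dimensions and the trace condition of
`State.Strong`. -/
theorem isStrong_of_trace {M N : Type} [L.Structure M] [L.Structure N] (f : M ↪[L] N)
    (hN : InK α N)
    (h : ∀ X : Finset N, ∃ Y : Finset M, (∀ a, a ∈ Y ↔ f a ∈ X) ∧ delta α Y ≤ delta α X) :
    IsStrong α f := by
  intro X
  apply le_antisymm
  · refine le_dim fun B hB => ?_
    obtain ⟨Y, hY, hle⟩ := h B
    refine (dim_le (hN.of_embedding f) fun a ha => ?_).trans hle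
    exact (hY a).2 (hB (Finset.mem_map_of_mem f.toEmbedding ha))
  · refine le_dim fun B hB => ?_
    rw [← delta_map f]
    exact dim_le hN (Finset.map_subset_map.2 hB)

/-- For finite `M` the dimension of all of `M` is its predimension, so the image of `M` has
predimension at most that of its union with `X`. Submodularity turns this into the inequality for
the intersection. -/
theorem IsStrong.delta_inter_le (hα : ∀ R, 0 ≤ α R) {M N : Type} [L.Structure M] [L.Structure N]
    [Fintype M] [DecidableEq N] {f : M ↪[L] N} (hN : InK α N) (hf : IsStrong α f) (X : Finset N) :
    delta α (X ∩ Finset.univ.map f.toEmbedding) ≤ delta α X := by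
  have h1 := hf Finset.univ
  have h2 : delta α (Finset.univ : Finset M) ≤ dim α (Finset.univ : Finset M) :=
    le_dim fun B hB => by rw [Finset.univ_subset_iff.1 hB]
  have h3 := dim_le hN (X := Finset.univ.map f.toEmbedding)
    (B := X ∪ Finset.univ.map f.toEmbedding) Finset.subset_union_right
  have h4 := predim_submodular hα (edgeSet L N) X (Finset.univ.map f.toEmbedding)
  rw [← delta_map f] at h2
  simp only [← delta_eq_predim] at h4
  linarith

end Structures

/-! ### Finite hypergraphs on natural numbers, and free amalgamation. -/

section States

variable {L : FirstOrder.Language.{0, 0}}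

/-- The action of an injection on edges. -/
def mapEdge {V W : Type} (j : V ↪ W) : Edge L V ↪ Edge L W :=
  (Function.Embedding.refl _).prodMap (Finset.mapEmbedding j).toEmbedding

theorem mapEdge_apply {V W : Type} (j : V ↪ W) (R : Σ n, L.Relations n) (s : Finset V) :
    mapEdge j (R, s) = (R, s.map j) := rfl

/-- Used to move new vertices away from `Q`, so that two states meet only in the part to be
amalgamated. -/
theorem exists_embedding_extending {T : Type} [Countable T] (A : Set T) (hA : A.Finite)
    (f : T → ℕ) (hf : Set.InjOn f A) (Q : Finset ℕ) :
    ∃ σ : T ↪ ℕ, (∀ t ∈ A, σ t = f t) ∧ ∀ t ∉ A, σ t ∉ Q := by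
  classical
  obtain ⟨e, he⟩ := exists_injective_nat T
  obtain ⟨N, hN⟩ := (Q ∪ hA.toFinset.image f).exists_nat_subset_range
  have hlt : ∀ t ∈ A, f t < N := fun t ht => Finset.mem_range.1 <| hN <|
    Finset.mem_union_right _ (Finset.mem_image_of_mem f (hA.mem_toFinset.2 ht))
  have hinj : Function.Injective fun t => if t ∈ A then f t else e t + N := by
    intro s t hst
    by_cases hs : s ∈ A <;> by_cases ht : t ∈ A <;> simp only [hs, ht, if_true, if_false] at hst
    · exact hf hs ht hst
    · have := hlt s hs; omega
    · have := hlt t ht; omega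
    · exact he (by omega)
  refine ⟨⟨_, hinj⟩, fun t ht => if_pos ht, fun t ht hQ => ?_⟩
  have := Finset.mem_range.1 (hN (Finset.mem_union_left _ hQ))
  rw [Function.Embedding.coeFn_mk, if_neg ht] at this
  omega

variable [Fintype (Σ n, L.Relations n)]

/-- A finite hypergraph on a finite set of natural numbers that represents a member of `K_α`. -/
@[ext]
structure State (α : (Σ n, L.Relations n) → ℝ) where
  /-- the vertices -/
  verts : Finset ℕ
  /-- the edges -/
  edges : Finset (Edge L ℕ)
  subset : ∀ e ∈ edges, e.2 ⊆ verts
  card_eq : ∀ e ∈ edges, e.2.card = e.1.1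
  predim_nonneg : ∀ X ⊆ verts, 0 ≤ predim α (edges : Set (Edge L ℕ)) X

namespace State

variable {α : (Σ n, L.Relations n) → ℝ}

/-- `p` is a strong substructure of the hypergraph `E` on the set `V`. -/
structure Strong (p : State α) (V : Set ℕ) (E : Set (Edge L ℕ)) : Prop where
  verts_subset : (p.verts : Set ℕ) ⊆ V
  mem_iff : ∀ e : Edge L ℕ, e.2 ⊆ p.verts → (e ∈ p.edges ↔ e ∈ E)
  le_predim : ∀ X : Finset ℕ, (X : Set ℕ) ⊆ V → predim α E (X ∩ p.verts) ≤ predim α E X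

theorem Strong.trans {p q : State α} {V : Set ℕ} {E : Set (Edge L ℕ)}
    (hpq : p.Strong q.verts q.edges) (hq : q.Strong V E) : p.Strong V E := by
  have hs : p.verts ⊆ q.verts := by simpa using hpq.verts_subset
  refine ⟨hpq.verts_subset.trans hq.verts_subset, fun e he => ?_, fun X hX => ?_⟩
  · rw [hpq.mem_iff e he, Finset.mem_coe, hq.mem_iff e (he.trans hs)]
  · refine le_trans ?_ (hq.le_predim X hX)
    have h1 := hpq.le_predim (X ∩ q.verts) (by simp)
    have hc : ∀ Y : Finset ℕ, Y ⊆ q.verts →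
        predim α (q.edges : Set (Edge L ℕ)) Y = predim α E Y :=
      fun Y hY => predim_congr fun e he => hq.mem_iff e (he.trans hY)
    rw [hc _ Finset.inter_subset_right,
      hc _ (Finset.inter_subset_left.trans Finset.inter_subset_right), Finset.inter_assoc,
      Finset.inter_eq_right.2 hs] at h1
    exact h1

/-- The state order is the strong substructure relation. -/
instance : Preorder (State α) where
  le p q := p.Strong q.verts q.edges
  le_refl p := ⟨subset_rfl, fun _ _ => by simp, fun X hX => by
    rw [Finset.inter_eq_left.2 (by simpa using hX)]⟩
  le_trans p q r hpq hqr := hpq.trans hqr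

theorem le_iff {p q : State α} : p ≤ q ↔ p.verts ⊆ q.verts ∧
    (∀ e : Edge L ℕ, e.2 ⊆ p.verts → (e ∈ p.edges ↔ e ∈ q.edges)) ∧
    ∀ X ⊆ q.verts, predim α (q.edges : Set (Edge L ℕ)) (X ∩ p.verts) ≤
      predim α (q.edges : Set (Edge L ℕ)) X :=
  ⟨fun h => ⟨by simpa using h.1, h.2, fun X hX => h.3 X (by simpa using hX)⟩,
    fun ⟨h1, h2, h3⟩ => ⟨by simpa using h1, h2, fun X hX => h3 X (by simpa using hX)⟩⟩

/-- The image of a state under an injection. -/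
def map (p : State α) (σ : ℕ ↪ ℕ) : State α where
  verts := p.verts.map σ
  edges := p.edges.map (mapEdge σ)
  subset e he := by
    obtain ⟨⟨R, s⟩, h, rfl⟩ := Finset.mem_map.1 he
    exact Finset.map_subset_map.2 (p.subset _ h)
  card_eq e he := by
    obtain ⟨⟨R, s⟩, h, rfl⟩ := Finset.mem_map.1 he
    simpa [mapEdge_apply] using p.card_eq _ h
  predim_nonneg X hX := by
    obtain ⟨Y, hY, rfl⟩ := Finset.subset_map_iff.1 hX
    refine (p.predim_nonneg Y hY).trans_eq (predim_map σ fun R s _ => ?_).symm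
    rw [Finset.mem_coe, ← mapEdge_apply, Finset.mem_map', Finset.mem_coe]

theorem mem_edges_map {p : State α} {σ : ℕ ↪ ℕ} {R : Σ n, L.Relations n} {s : Finset ℕ} :
    (R, s.map σ) ∈ (p.map σ).edges ↔ (R, s) ∈ p.edges := by
  rw [← mapEdge_apply]
  exact Finset.mem_map' _

theorem predim_map_edges (p : State α) (σ : ℕ ↪ ℕ) (X : Finset ℕ) :
    predim α ((p.map σ).edges : Set (Edge L ℕ)) (X.map σ) =
      predim α (p.edges : Set (Edge L ℕ)) X :=
  predim_map σ fun _ _ _ => mem_edges_map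

theorem map_congr (p : State α) {σ τ : ℕ ↪ ℕ} (h : ∀ n ∈ p.verts, σ n = τ n) :
    p.map σ = p.map τ := by
  classical
  have key : ∀ s ⊆ p.verts, s.map σ = s.map τ := fun s hs => by
    rw [Finset.map_eq_image, Finset.map_eq_image]
    exact Finset.image_congr fun n hn => h n (hs hn)
  ext1
  · exact key _ subset_rfl
  · change p.edges.map _ = p.edges.map _
    rw [Finset.map_eq_image, Finset.map_eq_image]
    refine Finset.image_congr fun e he => ?_
    obtain ⟨R, s⟩ := e
    rw [mapEdge_apply, mapEdge_apply, key s (p.subset _ he)]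

theorem map_eq_self (p : State α) {σ : ℕ ↪ ℕ} (h : ∀ n ∈ p.verts, σ n = n) : p.map σ = p := by
  rw [p.map_congr (τ := Function.Embedding.refl ℕ) h]
  ext1
  · exact Finset.map_refl
  · have : (mapEdge (Function.Embedding.refl ℕ) : Edge L ℕ ↪ Edge L ℕ) =
        Function.Embedding.refl _ := by
      ext1 ⟨R, s⟩
      rw [mapEdge_apply, Finset.map_refl]
      rfl
    change p.edges.map _ = p.edges
    rw [this, Finset.map_refl]

theorem map_le_map {p q : State α} (h : p ≤ q) (σ : ℕ ↪ ℕ) : p.map σ ≤ q.map σ := by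
  rw [le_iff] at h ⊢
  obtain ⟨h1, h2, h3⟩ := h
  refine ⟨Finset.map_subset_map.2 h1, ?_, fun X hX => ?_⟩
  · rintro ⟨R, s⟩ hs
    obtain ⟨t, ht, rfl⟩ := Finset.subset_map_iff.1 hs
    rw [mem_edges_map, mem_edges_map]
    exact h2 (R, t) ht
  · obtain ⟨Y, hY, rfl⟩ := Finset.subset_map_iff.1 hX
    have : Y.map σ ∩ (p.map σ).verts = (Y ∩ p.verts).map σ := (Finset.map_inter _ _).symm
    rw [this, predim_map_edges, predim_map_edges]
    exact h3 Y hY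

/-- Free amalgamation of `q` and `c` over a common substructure `a` that is strong in `c`. -/
theorem exists_amalgam {a q c : State α} (haq : a.verts ⊆ q.verts)
    (haq' : ∀ e : Edge L ℕ, e.2 ⊆ a.verts → (e ∈ a.edges ↔ e ∈ q.edges)) (hac : a ≤ c)
    (hdisj : q.verts ∩ c.verts ⊆ a.verts) :
    ∃ d : State α, q ≤ d ∧ c.verts ⊆ d.verts ∧
      (∀ e : Edge L ℕ, e.2 ⊆ c.verts → (e ∈ c.edges ↔ e ∈ d.edges)) ∧ (a ≤ q → c ≤ d) := by
  classical
  obtain ⟨hac1, hac2, hac3⟩ := le_iff.1 hac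
  have hV : q.verts ∩ c.verts = a.verts := hdisj.antisymm (Finset.subset_inter haq hac1)
  have hqc : ∀ e : Edge L ℕ, e.2 ⊆ q.verts ∩ c.verts → (e ∈ q.edges ↔ e ∈ c.edges) :=
    fun e he => by rw [← haq' e (hV ▸ he), hac2 e (hV ▸ he)]
  have hu : ∀ X ⊆ q.verts ∪ c.verts,
      predim α ((q.edges ∪ c.edges : Finset (Edge L ℕ)) : Set (Edge L ℕ)) X +
        predim α (c.edges : Set (Edge L ℕ)) (X ∩ a.verts) =
      predim α (q.edges : Set (Edge L ℕ)) (X ∩ q.verts) +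
        predim α (c.edges : Set (Edge L ℕ)) (X ∩ c.verts) := fun X hX => by
    rw [Finset.coe_union, ← hV]
    exact predim_union q.subset c.subset hqc hX
  have hca : ∀ X : Finset ℕ, X ∩ c.verts ∩ a.verts = X ∩ a.verts := fun X => by
    rw [Finset.inter_assoc, Finset.inter_eq_right.2 hac1]
  have hqa : ∀ X : Finset ℕ, X ∩ q.verts ∩ a.verts = X ∩ a.verts := fun X => by
    rw [Finset.inter_assoc, Finset.inter_eq_right.2 haq]
  -- By `hu`, the predimension of `X` exceeds that of its trace on `q` by the gain from `X ∩
  -- a.verts` to `X ∩ c.verts` in `c`, which is nonnegative since `a ≤ c`. Strength of `a` in `q`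
  -- plays no role here; it is needed only for `c ≤ d`.
  have hle : ∀ X ⊆ q.verts ∪ c.verts, predim α (q.edges : Set (Edge L ℕ)) (X ∩ q.verts) ≤
      predim α ((q.edges ∪ c.edges : Finset (Edge L ℕ)) : Set (Edge L ℕ)) X := fun X hX => by
    have h1 := hu X hX
    have h2 := hac3 (X ∩ c.verts) Finset.inter_subset_right
    rw [hca] at h2
    linarith
  have hqd : ∀ e : Edge L ℕ, e.2 ⊆ q.verts → (e ∈ q.edges ↔ e ∈ q.edges ∪ c.edges) :=
    fun e he => by
      rw [Finset.mem_union]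
      exact ⟨Or.inl, fun h => h.elim id fun h =>
        (hqc e (Finset.subset_inter he (c.subset e h))).2 h⟩
  have hcd : ∀ e : Edge L ℕ, e.2 ⊆ c.verts → (e ∈ c.edges ↔ e ∈ q.edges ∪ c.edges) :=
    fun e he => by
      rw [Finset.mem_union]
      exact ⟨Or.inr, fun h => h.elim (fun h =>
        (hqc e (Finset.subset_inter (q.subset e h) he)).1 h) id⟩
  let d : State α :=
    { verts := q.verts ∪ c.verts
      edges := q.edges ∪ c.edges
      subset := fun e he => (Finset.mem_union.1 he).elim
        (fun h => (q.subset e h).trans Finset.subset_union_left)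
        (fun h => (c.subset e h).trans Finset.subset_union_right)
      card_eq := fun e he => (Finset.mem_union.1 he).elim (q.card_eq e) (c.card_eq e)
      predim_nonneg := fun X hX =>
        (q.predim_nonneg _ Finset.inter_subset_right).trans (hle X hX) }
  refine ⟨d, le_iff.2 ⟨Finset.subset_union_left, hqd, fun X hX => ?_⟩, Finset.subset_union_right,
    hcd, fun h => le_iff.2 ⟨Finset.subset_union_right, hcd, fun X hX => ?_⟩⟩
  · rw [← predim_congr (E := q.edges) fun e he => hqd e (he.trans Finset.inter_subset_right)]
    exact hle X hX
  · rw [← predim_congr (E := c.edges) fun e he => hcd e (he.trans Finset.inter_subset_right)]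
    have h1 := hu X hX
    have h2 := (le_iff.1 h).2.2 (X ∩ q.verts) Finset.inter_subset_right
    rw [hqa, predim_congr (F := c.edges) fun e he =>
      hqc e (he.trans (Finset.inter_subset_right.trans hV.ge))] at h2
    change _ ≤ predim α ((q.edges ∪ c.edges : Finset (Edge L ℕ)) : Set (Edge L ℕ)) X
    linarith

/-- The edgeless state on a given set of vertices. -/
def discrete (α : (Σ n, L.Relations n) → ℝ) (V : Finset ℕ) : State α where
  verts := V
  edges := ∅
  subset := by simp
  card_eq := by simp
  predim_nonneg X _ := by simp [predim, edgesIn]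

/-- An edge on the empty set would give the empty set negative predimension. -/
theorem nonempty_of_mem_edges (hα : ∀ R, 0 < α R) (p : State α) {e : Edge L ℕ}
    (he : e ∈ p.edges) : e.2.Nonempty := by
  rw [Finset.nonempty_iff_ne_empty]
  intro h0
  have h1 := p.predim_nonneg ∅ (by simp)
  have h2 : α e.1 ≤ ∑ e ∈ edgesIn (p.edges : Set (Edge L ℕ)) ∅, α e.1 :=
    Finset.single_le_sum (f := fun e : Edge L ℕ => α e.1) (fun e _ => (hα e.1).le)
      (mem_edgesIn.2 ⟨he, h0.le⟩)
  have h3 := hα e.1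
  simp only [predim, Finset.card_empty, Nat.cast_zero] at h1
  linarith

theorem discrete_empty_le (hα : ∀ R, 0 < α R) (p : State α) : discrete α ∅ ≤ p := by
  refine le_iff.2 ⟨by simp [discrete], fun e he => ?_, fun X hX => ?_⟩
  · have h2 : e.2 = ∅ := Finset.subset_empty.1 he
    simp only [discrete, Finset.notMem_empty, false_iff]
    intro h
    simpa [h2] using p.nonempty_of_mem_edges hα h
  · have : predim α (p.edges : Set (Edge L ℕ)) (X ∩ (discrete α ∅).verts) ≤ 0 := by
      have hE : edgesIn (p.edges : Set (Edge L ℕ)) ∅ = ∅ := by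
        ext e
        simp only [mem_edgesIn, Finset.notMem_empty, iff_false, Finset.subset_empty]
        rintro ⟨h, h2⟩
        simpa [h2] using p.nonempty_of_mem_edges hα h
      simp [discrete, predim, hE]
    exact this.trans (p.predim_nonneg X hX)

end State

end States

/-! ### Construction of generic sequences and extension of embeddings. -/

section GenericSequence

variable {L : FirstOrder.Language.{0, 0}} [Fintype (Σ n, L.Relations n)]

instance {α : (Σ n, L.Relations n) → ℝ} : Countable (State α) :=
  Function.Injective.countable (f := fun p : State α => (p.verts, p.edges)) fun _ _ h =>
    State.ext (congrArg Prod.fst h) (congrArg Prod.snd h)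

/-- An increasing sequence of states that exhausts `ℕ` and realizes, up to renaming, every strong
extension of every strong substructure. -/
structure GenericSequence (α : (Σ n, L.Relations n) → ℝ) where
  /-- the states of the sequence -/
  seq : ℕ → State α
  mono : Monotone seq
  exhaust : ∀ n, ∃ i, n ∈ (seq i).verts
  extend : ∀ a b, a ≤ b → ∀ i, a ≤ seq i →
    ∃ (ρ : ℕ ↪ ℕ) (k : ℕ), (∀ n ∈ a.verts, ρ n = n) ∧ b.map ρ ≤ seq k

variable {α : (Σ n, L.Relations n) → ℝ}

theorem isCofinal_mem_verts (hα : ∀ R, 0 < α R) (n : ℕ) :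
    IsCofinal {p : State α | n ∈ p.verts} := fun p => by
  by_cases hn : n ∈ p.verts
  · exact ⟨p, hn, le_rfl⟩
  obtain ⟨d, hd, hc, -⟩ := State.exists_amalgam (a := State.discrete α ∅) (q := p)
    (c := State.discrete α {n}) (by simp [State.discrete])
    (State.le_iff.1 (State.discrete_empty_le hα p)).2.1 (State.discrete_empty_le hα _)
    (by simp [State.discrete, hn])
  exact ⟨d, hc (by simp [State.discrete]), hd⟩

/-- If some state above `p` has `a` as a strong part, a copy of `b` over `a` with fresh vertices is
amalgamated there. The second alternative covers the remaining `p` and never occurs along a sequence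
in which `a` becomes strong. -/
theorem isCofinal_extension {a b : State α} (hab : a ≤ b) :
    IsCofinal {p : State α | (∃ ρ : ℕ ↪ ℕ, (∀ n ∈ a.verts, ρ n = n) ∧ b.map ρ ≤ p) ∨
      ∀ q, p ≤ q → ¬ a ≤ q} := fun p => by
  by_cases h : ∀ q, p ≤ q → ¬ a ≤ q
  · exact ⟨p, Or.inr h, le_rfl⟩
  push Not at h
  obtain ⟨q, hpq, haq⟩ := h
  obtain ⟨ρ, hρ, hρ'⟩ := exists_embedding_extending (a.verts : Set ℕ) a.verts.finite_toSet id
    Function.injective_id.injOn q.verts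
  have hρ1 : ∀ n ∈ a.verts, ρ n = n := hρ
  have hab' : a ≤ b.map ρ := by
    have := State.map_le_map hab ρ
    rwa [a.map_eq_self hρ1] at this
  obtain ⟨d, hqd, -, -, hd⟩ := State.exists_amalgam (State.le_iff.1 haq).1
    (State.le_iff.1 haq).2.1 hab' fun n hn => by
      obtain ⟨h1, h2⟩ := Finset.mem_inter.1 hn
      obtain ⟨m, -, rfl⟩ := Finset.mem_map.1 h2
      by_cases hm : m ∈ a.verts
      · rwa [hρ1 m hm]
      · exact absurd h1 (hρ' m hm)
  exact ⟨d, Or.inl ⟨ρ, hρ1, hd haq⟩, hpq.trans hqd⟩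

theorem GenericSequence.exists_start (hα : ∀ R, 0 < α R) (p₀ : State α) :
    ∃ G : GenericSequence α, G.seq 0 = p₀ := by
  let D : ℕ ⊕ {ab : State α × State α // ab.1 ≤ ab.2} → Order.Cofinal (State α) :=
    Sum.elim (fun n => ⟨_, isCofinal_mem_verts hα n⟩) fun ab => ⟨_, isCofinal_extension ab.2⟩
  let := Encodable.ofCountable (ℕ ⊕ {ab : State α × State α // ab.1 ≤ ab.2})
  have hmono := Order.sequenceOfCofinals.monotone p₀ D
  have hmem := Order.sequenceOfCofinals.encode_mem p₀ D
  refine ⟨⟨Order.sequenceOfCofinals p₀ D, hmono, fun n => ⟨_, hmem (Sum.inl n)⟩,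
    fun a b hab i hi => ?_⟩, rfl⟩
  rcases hmem (Sum.inr ⟨(a, b), hab⟩) with ⟨ρ, hρ, hle⟩ | h
  · exact ⟨ρ, _, hρ, hle⟩
  -- Once strong in `seq i`, `a` remains strong in all later states, which excludes the second
  -- alternative.
  · exact absurd (hi.trans (hmono (le_max_right _ i))) (h _ (hmono (le_max_left _ i)))

namespace GenericSequence

variable (G : GenericSequence α)

/-- The union of the edge sets of a generic sequence. -/
def edges : Set (Edge L ℕ) := {e | ∃ i, e ∈ (G.seq i).edges}

theorem exists_subset (X : Finset ℕ) : ∃ i, X ⊆ (G.seq i).verts := by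
  choose i hi using G.exhaust
  exact ⟨X.sup i, fun n hn => (State.le_iff.1 (G.mono (Finset.le_sup hn))).1 (hi n)⟩

theorem mem_edges_iff {i : ℕ} {e : Edge L ℕ} (he : e.2 ⊆ (G.seq i).verts) :
    e ∈ (G.seq i).edges ↔ e ∈ G.edges := by
  refine ⟨fun h => ⟨i, h⟩, fun ⟨j, hj⟩ => ?_⟩
  rcases le_total i j with hij | hji
  · exact ((State.le_iff.1 (G.mono hij)).2.1 e he).2 hj
  · exact ((State.le_iff.1 (G.mono hji)).2.1 e ((G.seq j).subset e hj)).1 hj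

theorem card_eq {e : Edge L ℕ} (he : e ∈ G.edges) : e.2.card = e.1.1 :=
  he.elim fun i hi => (G.seq i).card_eq e hi

theorem predim_eq {i : ℕ} {X : Finset ℕ} (hX : X ⊆ (G.seq i).verts) :
    predim α ((G.seq i).edges : Set (Edge L ℕ)) X = predim α G.edges X :=
  predim_congr fun _ he => G.mem_edges_iff (he.trans hX)

theorem predim_nonneg (X : Finset ℕ) : 0 ≤ predim α G.edges X := by
  obtain ⟨i, hi⟩ := G.exists_subset X
  rw [← G.predim_eq hi]
  exact (G.seq i).predim_nonneg X hi

theorem strong_seq (i : ℕ) : (G.seq i).Strong Set.univ G.edges where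
  verts_subset := Set.subset_univ _
  mem_iff _ he := G.mem_edges_iff he
  le_predim X _ := by
    obtain ⟨j, hj⟩ := G.exists_subset X
    obtain ⟨-, -, h⟩ := State.le_iff.1 (G.mono (le_max_left i j))
    have hX : X ⊆ (G.seq (max i j)).verts :=
      hj.trans (State.le_iff.1 (G.mono (le_max_right i j))).1
    rw [← G.predim_eq hX, ← G.predim_eq (Finset.inter_subset_left.trans hX)]
    exact h X hX

theorem le_seq {a : State α} (ha : a.Strong Set.univ G.edges) {i : ℕ}
    (hi : a.verts ⊆ (G.seq i).verts) : a ≤ G.seq i := by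
  refine State.le_iff.2 ⟨hi, fun e he => ?_, fun X hX => ?_⟩
  · rw [G.mem_edges_iff (he.trans hi)]
    exact ha.mem_iff e he
  · rw [G.predim_eq hX, G.predim_eq (Finset.inter_subset_left.trans hX)]
    exact ha.le_predim X (Set.subset_univ _)

theorem exists_strong_map {a b : State α} (ha : a.Strong Set.univ G.edges) (hab : a ≤ b) :
    ∃ ρ : ℕ ↪ ℕ, (∀ n ∈ a.verts, ρ n = n) ∧ (b.map ρ).Strong Set.univ G.edges := by
  obtain ⟨i, hi⟩ := G.exists_subset a.verts
  obtain ⟨ρ, k, hρ, hk⟩ := G.extend a b hab i (G.le_seq ha hi)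
  exact ⟨ρ, hρ, State.Strong.trans hk (G.strong_seq k)⟩

/-- The injection `f` embeds the state `p` into the generic structure (not necessarily strongly). -/
def Embeds (p : State α) (f : ℕ ↪ ℕ) : Prop :=
  ∀ e : Edge L ℕ, e.2 ⊆ p.verts → (e ∈ p.edges ↔ mapEdge f e ∈ G.edges)

/-- Every embedding of `p` into the generic structure extends to any strong extension of `p`. -/
theorem Embeds.extend {G : GenericSequence α} {p p' : State α} (hp : p ≤ p') {f : ℕ ↪ ℕ}
    (hf : G.Embeds p f) : ∃ f' : ℕ ↪ ℕ, (∀ n ∈ p.verts, f' n = f n) ∧ G.Embeds p' f' := by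
  obtain ⟨i, hi⟩ := G.exists_subset (p.verts.map f)
  obtain ⟨σ, hσ, hσ'⟩ := exists_embedding_extending (p.verts : Set ℕ) p.verts.finite_toSet f
    f.injective.injOn (G.seq i).verts
  have hσ1 : ∀ n ∈ p.verts, σ n = f n := hσ
  have hle : p.map f ≤ p'.map σ := by
    have := State.map_le_map hp σ
    rwa [p.map_congr hσ1] at this
  -- The image of `p` need not be strong in `G.seq i`, so only `G.seq i ≤ d` is available. That
  -- suffices to realize `d` over `G.seq i` in the generic structure.
  obtain ⟨d, hqd, hd1, hd2, -⟩ := State.exists_amalgam (a := p.map f) (q := G.seq i)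
    (c := p'.map σ) hi (fun e he => by
      rw [G.mem_edges_iff (he.trans hi)]
      obtain ⟨R, s⟩ := e
      obtain ⟨t, ht, rfl⟩ := Finset.subset_map_iff.1 he
      rw [State.mem_edges_map]
      exact hf (R, t) ht) hle fun n hn => by
      obtain ⟨h1, h2⟩ := Finset.mem_inter.1 hn
      obtain ⟨m, -, rfl⟩ := Finset.mem_map.1 h2
      by_cases hm : m ∈ p.verts
      · rw [hσ1 m hm]
        exact Finset.mem_map_of_mem f hm
      · exact absurd h1 (hσ' m hm)
  obtain ⟨ρ, hρ, hs⟩ := G.exists_strong_map (G.strong_seq i) hqd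
  refine ⟨σ.trans ρ, fun n hn => ?_, ?_⟩
  · rw [Function.Embedding.trans_apply, hσ1 n hn]
    exact hρ _ (hi (Finset.mem_map_of_mem f hn))
  · rintro ⟨R, s⟩ hsub
    rw [mapEdge_apply, ← Finset.map_map, ← State.mem_edges_map (σ := σ),
      hd2 (R, s.map σ) (Finset.map_subset_map.2 hsub), ← State.mem_edges_map (σ := ρ)]
    exact hs.mem_iff (R, (s.map σ).map ρ) (Finset.map_subset_map.2
      ((Finset.map_subset_map.2 hsub).trans hd1))

/-- An embedding of the first state extends to the whole generic structure. -/
theorem Embeds.extend_univ {G : GenericSequence α} {f : ℕ ↪ ℕ} (hf : G.Embeds (G.seq 0) f) :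
    ∃ F : ℕ ↪ ℕ, (∀ n ∈ (G.seq 0).verts, F n = f n) ∧
      ∀ e : Edge L ℕ, e ∈ G.edges ↔ mapEdge F e ∈ G.edges := by
  have step : ∀ i (g : {g : ℕ ↪ ℕ // G.Embeds (G.seq i) g}),
      ∃ g' : {g : ℕ ↪ ℕ // G.Embeds (G.seq (i + 1)) g}, ∀ n ∈ (G.seq i).verts, g'.1 n = g.1 n :=
    fun i g => by
      obtain ⟨g', h1, h2⟩ := g.2.extend (G.mono (Nat.le_succ i))
      exact ⟨⟨g', h2⟩, h1⟩
  choose next hnext using step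
  let g : ∀ i, {g : ℕ ↪ ℕ // G.Embeds (G.seq i) g} := fun i =>
    Nat.rec (motive := fun i => {g : ℕ ↪ ℕ // G.Embeds (G.seq i) g}) ⟨f, hf⟩ next i
  have hg : ∀ i j, i ≤ j → ∀ n ∈ (G.seq i).verts, (g j).1 n = (g i).1 n := by
    intro i j hij n hn
    induction j, hij using Nat.le_induction with
    | base => rfl
    | succ j hij ih => rw [← ih]; exact hnext j (g j) n ((State.le_iff.1 (G.mono hij)).1 hn)
  choose idx hidx using G.exhaust
  have hF : ∀ j, ∀ n ∈ (G.seq j).verts, (g (idx n)).1 n = (g j).1 n := fun j n hn => by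
    rcases le_total (idx n) j with h | h
    · exact (hg _ _ h n (hidx n)).symm
    · exact hg _ _ h n hn
  have hinj : Function.Injective fun n => (g (idx n)).1 n := fun m n h => by
    obtain ⟨j, hj⟩ := G.exists_subset {m, n}
    simp only at h
    rw [hF j m (hj (by simp)), hF j n (hj (by simp))] at h
    exact (g j).1.injective h
  refine ⟨⟨_, hinj⟩, fun n hn => hF 0 n hn, fun e => ?_⟩
  obtain ⟨j, hj⟩ := G.exists_subset e.2
  have he : mapEdge ⟨_, hinj⟩ e = mapEdge (g j).1 e := by
    obtain ⟨R, s⟩ := e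
    rw [mapEdge_apply, mapEdge_apply, Finset.map_eq_image, Finset.map_eq_image]
    congr 1
    exact Finset.image_congr fun n hn => hF j n (hj hn)
  rw [he, ← (g j).2 e hj, G.mem_edges_iff hj]

end GenericSequence

end GenericSequence

/-! ### The union of a generic sequence is a generic structure. -/

section GenericModel

variable {L : FirstOrder.Language.{0, 0}}

/-- The relational structure on `ℕ` with the given edges. -/
@[reducible]
def structureOfEdges [L.IsRelational] (E : Set (Edge L ℕ)) : L.Structure ℕ where
  funMap f := isEmptyElim f
  RelMap {n} R x := Function.Injective x ∧ ((⟨n, R⟩, Finset.univ.image x) : Edge L ℕ) ∈ E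

theorem symmIrrefl_structureOfEdges [L.IsRelational] (E : Set (Edge L ℕ)) :
    letI := structureOfEdges E
    SymmIrrefl L ℕ := by
  intro n R x hx
  refine ⟨hx.1, fun σ => ⟨hx.1.comp σ.injective, ?_⟩⟩
  have : Finset.univ.image (x ∘ σ) = Finset.univ.image x :=
    Finset.coe_injective (by simp [-Function.comp_apply, σ.surjective.range_comp x])
  rw [this]
  exact hx.2

theorem edgeSet_structureOfEdges [L.IsRelational] {E : Set (Edge L ℕ)}
    (hE : ∀ e ∈ E, e.2.card = e.1.1) :
    letI := structureOfEdges E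
    edgeSet L ℕ = E := by
  let := structureOfEdges E
  ext ⟨⟨n, R⟩, s⟩
  constructor
  · rintro ⟨x, hx, hs⟩
    have : Finset.univ.image x = s := Finset.coe_injective (by simpa using hs)
    exact this ▸ hx.2
  · intro he
    have hr := s.range_orderEmbOfFin (hE _ he)
    have hi : Finset.univ.image (s.orderEmbOfFin (hE _ he)) = s :=
      Finset.coe_injective (by simp)
    exact ⟨s.orderEmbOfFin (hE _ he), ⟨(s.orderEmbOfFin _).injective, hi.symm ▸ he⟩, hr⟩

theorem card_eq_of_mem_edgeSet {M : Type} [L.Structure M] (h : SymmIrrefl L M) {e : Edge L M}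
    (he : e ∈ edgeSet L M) : e.2.card = e.1.1 := by
  obtain ⟨x, hx, hs⟩ := he
  rw [← Set.ncard_coe_finset, ← hs, ← Set.image_univ, Set.ncard_image_of_injective _ (h _ _ _ hx).1]
  simp [Set.ncard_univ]

variable [Fintype (Σ n, L.Relations n)] {α : (Σ n, L.Relations n) → ℝ}

/-- The copy of a finite member of `K_α` on the image of an injection into `ℕ`. -/
noncomputable def State.ofEmbedding {B : Type} [L.Structure B] [Fintype B] (hB : InK α B)
    (j : B ↪ ℕ) : State α where
  verts := Finset.univ.map j
  edges := (edgesIn (edgeSet L B) Finset.univ).map (mapEdge j)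
  subset e he := by
    obtain ⟨⟨R, s⟩, -, rfl⟩ := Finset.mem_map.1 he
    exact Finset.map_subset_map.2 (Finset.subset_univ s)
  card_eq e he := by
    obtain ⟨⟨R, s⟩, h, rfl⟩ := Finset.mem_map.1 he
    simpa [mapEdge_apply] using card_eq_of_mem_edgeSet hB.1 (mem_edgesIn.1 h).1
  predim_nonneg X hX := by
    obtain ⟨Y, hY, rfl⟩ := Finset.subset_map_iff.1 hX
    refine ((hB.2 Y).trans_eq (delta_eq_predim α Y)).trans_eq (predim_map j fun R s _ => ?_).symm
    rw [Finset.mem_coe, ← mapEdge_apply, Finset.mem_map', mem_edgesIn]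
    simp

theorem State.mem_edges_ofEmbedding {B : Type} [L.Structure B] [Fintype B] (hB : InK α B)
    (j : B ↪ ℕ) (R : Σ n, L.Relations n) (s : Finset B) :
    (R, s.map j) ∈ (State.ofEmbedding hB j).edges ↔ (R, s) ∈ edgeSet L B := by
  rw [← mapEdge_apply]
  simp [State.ofEmbedding]

theorem State.predim_ofEmbedding {B : Type} [L.Structure B] [Fintype B] (hB : InK α B)
    (j : B ↪ ℕ) (X : Finset B) :
    predim α ((State.ofEmbedding hB j).edges : Set (Edge L ℕ)) (X.map j) = delta α X := by
  rw [delta_eq_predim]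
  exact predim_map j fun R s _ => State.mem_edges_ofEmbedding hB j R s

theorem State.ofEmbedding_le (hα : ∀ R, 0 ≤ α R) {A B : Type} [L.Structure A] [L.Structure B]
    [Fintype A] [Fintype B] (hA : InK α A) (hB : InK α B) {g : A ↪[L] B} (hg : IsStrong α g)
    (j : B ↪ ℕ) : State.ofEmbedding hA (g.toEmbedding.trans j) ≤ State.ofEmbedding hB j := by
  classical
  have hmap : ∀ s : Finset A, s.map (g.toEmbedding.trans j) = (s.map g.toEmbedding).map j :=
    fun s => (Finset.map_map _ _ _).symm
  refine State.le_iff.2 ⟨?_, ?_, fun X hX => ?_⟩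
  · change Finset.univ.map _ ⊆ _
    rw [hmap]
    exact Finset.map_subset_map.2 (Finset.subset_univ _)
  · rintro ⟨R, s⟩ hs
    obtain ⟨t, ht, rfl⟩ := Finset.subset_map_iff.1 hs
    rw [State.mem_edges_ofEmbedding, hmap, State.mem_edges_ofEmbedding, mem_edgeSet_map_iff]
  · obtain ⟨Y, hY, rfl⟩ := Finset.subset_map_iff.1 hX
    have : Y.map j ∩ (State.ofEmbedding hA (g.toEmbedding.trans j)).verts =
        (Y ∩ Finset.univ.map g.toEmbedding).map j := by
      rw [Finset.map_inter, ← hmap]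
      rfl
    rw [this, State.predim_ofEmbedding, State.predim_ofEmbedding]
    exact hg.delta_inter_le hα hB Y

namespace GenericSequence

variable [L.IsRelational] (G : GenericSequence α)

theorem edgeSet_eq :
    letI := structureOfEdges G.edges
    edgeSet L ℕ = G.edges :=
  edgeSet_structureOfEdges fun _ he => G.card_eq he

theorem delta_eq (X : Finset ℕ) :
    letI := structureOfEdges G.edges
    delta α X = predim α G.edges X := by
  let := structureOfEdges G.edges
  rw [delta_eq_predim, G.edgeSet_eq]

theorem inK :
    letI := structureOfEdges G.edges
    InK α ℕ :=
  ⟨symmIrrefl_structureOfEdges _, fun X => (G.predim_nonneg X).trans_eq (G.delta_eq X).symm⟩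

/-- `B` is copied to the naturals by a map `j` with `j ∘ g = f`, so that the state of `A` is
literally the image of `f`; the extension property for states then applies. -/
theorem exists_strong_extension (hα : ∀ R, 0 ≤ α R) {A B : Type} [L.Structure A] [L.Structure B]
    [Finite A] [Finite B] (hA : InK α A) (hB : InK α B) :
    letI := structureOfEdges G.edges
    ∀ (f : A ↪[L] ℕ) (g : A ↪[L] B), IsStrong α f → IsStrong α g →
      ∃ h : B ↪[L] ℕ, IsStrong α h ∧ ∀ a, h (g a) = f a := by
  classical
  let := structureOfEdges G.edges
  intro f g hf hg
  have := Fintype.ofFinite A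
  have := Fintype.ofFinite B
  have hext : ∀ x, Function.extend g f 0 (g x) = f x := g.injective.extend_apply f 0
  obtain ⟨j, hj, -⟩ := exists_embedding_extending (Set.range g) (Set.finite_range g)
    (Function.extend g f 0) (by
      rintro _ ⟨x, rfl⟩ _ ⟨y, rfl⟩ h
      rw [hext, hext] at h
      rw [f.injective h]) ∅
  have hjg : g.toEmbedding.trans j = f.toEmbedding := by
    ext x
    exact (hj (g x) ⟨x, rfl⟩).trans (hext x)
  have hab := State.ofEmbedding_le hα hA hB hg j
  rw [hjg] at hab
  have ha : (State.ofEmbedding hA f.toEmbedding).Strong Set.univ G.edges := by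
    refine ⟨Set.subset_univ _, ?_, fun X _ => ?_⟩
    · rintro ⟨R, s⟩ hs
      obtain ⟨t, ht, rfl⟩ := Finset.subset_map_iff.1 hs
      have hR := mem_edgeSet_map_iff f R t
      rw [State.mem_edges_ofEmbedding, ← hR, G.edgeSet_eq]
    · rw [← G.delta_eq, ← G.delta_eq]
      exact hf.delta_inter_le hα G.inK X
  obtain ⟨ρ, hρ, hs⟩ := G.exists_strong_map ha hab
  have hmap : ∀ s : Finset B, s.map (j.trans ρ) = (s.map j).map ρ :=
    fun s => (Finset.map_map _ _ _).symm
  have hv : ((State.ofEmbedding hB j).map ρ).verts = Finset.univ.map (j.trans ρ) :=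
    (hmap _).symm
  let h : B ↪[L] ℕ := embeddingOfEdges hB.1 G.inK.1 (j.trans ρ) fun R s => by
    have hsub : s.map (j.trans ρ) ⊆ ((State.ofEmbedding hB j).map ρ).verts := by
      rw [hv]
      exact Finset.map_subset_map.2 (Finset.subset_univ _)
    rw [G.edgeSet_eq, ← hs.mem_iff (R, s.map (j.trans ρ)) hsub, hmap, State.mem_edges_map,
      State.mem_edges_ofEmbedding]
  refine ⟨h, isStrong_of_trace h G.inK fun X => ?_, fun x => ?_⟩
  · refine ⟨Finset.univ.filter fun b => h b ∈ X, by simp, ?_⟩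
    have : (Finset.univ.filter fun b => h b ∈ X).map h.toEmbedding =
        X ∩ ((State.ofEmbedding hB j).map ρ).verts := by
      rw [hv]
      change _ = X ∩ Finset.univ.map h.toEmbedding
      ext n
      simp only [Finset.mem_map, Finset.mem_filter, Finset.mem_univ, true_and, Finset.mem_inter]
      constructor
      · rintro ⟨b, hb, rfl⟩
        exact ⟨hb, b, rfl⟩
      · rintro ⟨hn, b, rfl⟩
        exact ⟨b, hn, rfl⟩
    rw [← delta_map h, this, G.delta_eq, G.delta_eq]
    exact hs.le_predim X (Set.subset_univ _)
  · have h1 : j (g x) = f x := DFunLike.congr_fun hjg x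
    change ρ (j (g x)) = f x
    rw [h1]
    exact hρ _ (Finset.mem_map_of_mem f.toEmbedding (Finset.mem_univ x))

/-- The union of a generic sequence is a generic structure. -/
theorem isGeneric (hα : ∀ R, 0 ≤ α R) :
    letI := structureOfEdges G.edges
    IsGeneric α ℕ := by
  classical
  let := structureOfEdges G.edges
  refine ⟨inferInstance, G.inK, fun A B _ _ _ _ hA hB f g hf hg =>
    G.exists_strong_extension hα hA hB f g hf hg, ?_⟩
  let A : ℕ → L.Substructure ℕ := fun i => ⟨(G.seq i).verts, fun f => isEmptyElim f⟩
  have hfin : ∀ i, Finite (A i) := fun i => (G.seq i).verts.finite_toSet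
  have hA : ∀ i, InK α (A i) := fun i => G.inK.of_embedding (A i).subtype
  have hle : ∀ i, A i ≤ A (i + 1) := fun i => (G.mono (Nat.le_succ i)).verts_subset
  refine ⟨A, hle, fun i => ⟨hfin i, hA i⟩, fun i => ?_,
    G.exhaust⟩
  refine isStrong_of_trace _ (hA (i + 1)) fun X => ?_
  have := Fintype.ofFinite (A i)
  refine ⟨Finset.univ.filter fun a => Substructure.inclusion (hle i) a ∈ X,
    fun a => by rw [Finset.mem_filter, and_iff_right (Finset.mem_univ a)], ?_⟩
  rw [← delta_map (A i).subtype, ← delta_map (A (i + 1)).subtype, G.delta_eq, G.delta_eq]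
  refine le_of_eq_of_le ?_ ((G.strong_seq i).le_predim _ (Set.subset_univ _))
  congr 1
  ext n
  simp only [Finset.mem_map, Finset.mem_filter, Finset.mem_univ, true_and, Finset.mem_inter]
  constructor
  · rintro ⟨a, ha, rfl⟩
    exact ⟨⟨_, ha, rfl⟩, a.2⟩
  · rintro ⟨⟨b, hb, rfl⟩, hn⟩
    exact ⟨⟨b.1, hn⟩, hb, rfl⟩

end GenericSequence

end GenericModel

/-! ### The cone over `k` blocks and the formula asserting an apex. -/

section Cone

variable {L : FirstOrder.Language.{0, 0}} {k l : ℕ}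

/-- The tuple consisting of `c` and of the `j`-th of the `k` blocks of the tuple `v`. -/
def coneTuple {M : Type*} (v : Fin (k * (l + 1)) → M) (c : M) (j : Fin k) : Fin (l + 2) → M :=
  Fin.cons c fun i => v (finProdFinEquiv (j, i))

theorem comp_coneTuple {M N : Type*} (f : M → N) (v : Fin (k * (l + 1)) → M) (c : M) (j : Fin k) :
    f ∘ coneTuple v c j = coneTuple (f ∘ v) (f c) j := by
  funext i
  refine Fin.cases ?_ (fun i => ?_) i <;> simp [coneTuple]

theorem coneTuple_injective {M : Type*} {v : Fin (k * (l + 1)) → M} (hv : Function.Injective v)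
    {c : M} (hc : ∀ i, v i ≠ c) (j : Fin k) : Function.Injective (coneTuple v c j) := by
  refine Fin.cons_injective_iff.2 ⟨?_, fun i i' h => ?_⟩
  · rintro ⟨i, hi⟩
    exact hc _ hi
  · simpa using hv h

/-- Entry `1` is the first point of block `j`; it differs from `c`, so it determines the block. Thus
an apex yields `k` distinct edges. -/
theorem image_coneTuple_injective {M : Type*} [DecidableEq M] {v : Fin (k * (l + 1)) → M}
    (hv : Function.Injective v) {c : M} (hc : ∀ i, v i ≠ c) :
    Function.Injective fun j => Finset.univ.image (coneTuple v c j) := by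
  intro j j' h
  have hmem : coneTuple v c j 1 ∈ Finset.univ.image (coneTuple v c j') := by
    rw [← show Finset.univ.image (coneTuple v c j) = Finset.univ.image (coneTuple v c j') from h]
    exact Finset.mem_image_of_mem _ (Finset.mem_univ _)
  obtain ⟨i, -, hi⟩ := Finset.mem_image.1 hmem
  have h1 : coneTuple v c j 1 = v (finProdFinEquiv (j, 0)) := rfl
  rw [h1] at hi
  induction i using Fin.cases with
  | zero => exact absurd hi.symm (hc _)
  | succ i =>
    have := finProdFinEquiv.injective (hv hi)
    exact (congrArg Prod.fst this).symm

/-- The edge on the set of entries of `coneTuple v c j`. -/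
abbrev coneEdge {M : Type} [DecidableEq M] (R : L.Relations (l + 2)) (v : Fin (k * (l + 1)) → M)
    (c : M) (j : Fin k) : Edge L M :=
  (⟨l + 2, R⟩, Finset.univ.image (coneTuple v c j))

/-- There is an element that forms an edge with each of the `k` blocks of the tuple. -/
noncomputable def coneFormula (R : L.Relations (l + 2)) (k : ℕ) :
    L.Formula (Fin (k * (l + 1))) :=
  (BoundedFormula.iInf fun j : Fin k => R.boundedFormula
    (coneTuple (fun i => (Term.var (Sum.inl i) : L.Term (Fin (k * (l + 1)) ⊕ Fin 1)))
      (Term.var (Sum.inr 0)) j)).ex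

theorem realize_coneFormula {M : Type} [L.Structure M] (R : L.Relations (l + 2))
    (v : Fin (k * (l + 1)) → M) :
    (coneFormula R k).Realize v ↔ ∃ c, ∀ j, Structure.RelMap R (coneTuple v c j) := by
  rw [coneFormula, Formula.Realize, BoundedFormula.realize_ex]
  refine exists_congr fun c => ?_
  rw [BoundedFormula.realize_iInf]
  refine forall_congr' fun j => ?_
  rw [BoundedFormula.realize_rel]
  refine iff_of_eq (congrArg _ ?_)
  exact comp_coneTuple (fun t : L.Term (Fin (k * (l + 1)) ⊕ Fin 1) =>
    t.realize (Sum.elim v (Fin.snoc default c))) _ _ _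

variable [Fintype (Σ n, L.Relations n)] {α : (Σ n, L.Relations n) → ℝ}

theorem predim_nonneg_of_card_le (hα : ∀ R, α R ≤ 1) {V : Type} {E : Set (Edge L V)}
    {X : Finset V} (h : (edgesIn E X).card ≤ X.card) : 0 ≤ predim α E X := by
  have h1 : ∑ e ∈ edgesIn E X, α e.1 ≤ ∑ _e ∈ edgesIn E X, (1 : ℝ) :=
    Finset.sum_le_sum fun e _ => hα e.1
  have h2 : ((edgesIn E X).card : ℝ) ≤ X.card := by exact_mod_cast h
  simp only [Finset.sum_const, nsmul_eq_mul, mul_one] at h1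
  rw [predim]
  linarith

theorem val_ne_card {m : ℕ} (i : Fin m) : (i : ℕ) ≠ m := i.2.ne

open Classical in
/-- The state on `{0, …, k (l + 1)}` whose last vertex forms an edge with each of the `k` blocks of
the other vertices. -/
noncomputable def coneState (hα : ∀ R, α R ≤ 1) (R : L.Relations (l + 2)) (k : ℕ) : State α where
  verts := Finset.range (k * (l + 1) + 1)
  edges := Finset.univ.image (coneEdge (k := k) R Fin.val (k * (l + 1)))
  subset e he := by
    obtain ⟨j, -, rfl⟩ := Finset.mem_image.1 he
    intro n hn
    obtain ⟨i, -, rfl⟩ := Finset.mem_image.1 hn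
    rw [Finset.mem_range]
    refine Fin.cases (Nat.lt_succ_self (k * (l + 1))) (fun i => ?_) i
    exact (finProdFinEquiv (j, i)).2.trans (Nat.lt_succ_self _)
  card_eq e he := by
    obtain ⟨j, -, rfl⟩ := Finset.mem_image.1 he
    simp only
    rw [Finset.card_image_of_injective _ (coneTuple_injective Fin.val_injective val_ne_card j)]
    simp
  predim_nonneg X _ := by
    refine predim_nonneg_of_card_le hα ?_
    -- Each edge is charged to the first vertex of its block, which exists because the arity is at
    -- least `2`.
    let J : Finset (Fin k) := Finset.univ.filter fun j =>
      (finProdFinEquiv (j, (0 : Fin (l + 1))) : ℕ) ∈ X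
    have hJ : J.card ≤ X.card :=
      Finset.card_le_card_of_injOn (fun j => (finProdFinEquiv (j, (0 : Fin (l + 1))) : ℕ))
        (fun j hj => (Finset.mem_filter.1 hj).2) fun j _ j' _ h =>
          congrArg Prod.fst (finProdFinEquiv.injective (Fin.val_injective h))
    refine le_trans (Finset.card_le_card (t := J.image (coneEdge R Fin.val (k * (l + 1)))) ?_)
      (Finset.card_image_le.trans hJ)
    intro e he
    obtain ⟨h1, h2⟩ := mem_edgesIn.1 he
    obtain ⟨j, -, rfl⟩ := Finset.mem_image.1 (Finset.mem_coe.1 h1)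
    refine Finset.mem_image_of_mem _ (Finset.mem_filter.2 ⟨Finset.mem_univ j, h2 ?_⟩)
    exact Finset.mem_image.2 ⟨1, Finset.mem_univ _, rfl⟩

namespace GenericSequence

variable (G : GenericSequence α)

/-- The block vertices of a cone embed in the generic structure so that the cone is realized. -/
theorem exists_embeds_cone (hα : ∀ R, 0 < α R ∧ α R ≤ 1) (R : L.Relations (l + 2)) (k : ℕ) :
    ∃ ρ : ℕ ↪ ℕ, G.Embeds (State.discrete α (Finset.range (k * (l + 1)))) ρ ∧
      ∀ j : Fin k, coneEdge R (ρ ∘ Fin.val) (ρ (k * (l + 1))) j ∈ G.edges := by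
  classical
  have hpos : ∀ R, 0 < α R := fun R => (hα R).1
  let b : State α := coneState (fun R => (hα R).2) R k
  obtain ⟨i, hi⟩ := G.exists_subset ∅
  obtain ⟨ρ, -, hs⟩ := G.exists_strong_map
    (State.Strong.trans (State.discrete_empty_le hpos (G.seq i)) (G.strong_seq i))
    (State.discrete_empty_le hpos b)
  refine ⟨ρ, ?_, fun j => ?_⟩
  · rintro ⟨R', s⟩ hs'
    have hsub : s ⊆ b.verts := hs'.trans (Finset.range_subset_range.2 (Nat.le_succ _))
    rw [mapEdge_apply, ← hs.mem_iff (R', s.map ρ) (Finset.map_subset_map.2 hsub),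
      State.mem_edges_map]
    simp only [State.discrete, Finset.notMem_empty, false_iff]
    intro he
    obtain ⟨j, -, hj⟩ := Finset.mem_image.1 he
    obtain ⟨-, rfl⟩ := Prod.mk.inj hj
    -- Every edge of the cone contains the apex `k * (l + 1)`, so the base is edgeless.
    have : k * (l + 1) ∈ Finset.range (k * (l + 1)) :=
      hs' (Finset.mem_image.2 ⟨0, Finset.mem_univ _, rfl⟩)
    simp at this
  · have hb : coneEdge R Fin.val (k * (l + 1)) j ∈ b.edges :=
      Finset.mem_image_of_mem _ (Finset.mem_univ j)
    rw [coneEdge, ← comp_coneTuple, ← Finset.image_image, ← Finset.map_eq_image]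
    exact (hs.mem_iff _ (Finset.map_subset_map.2 (b.subset _ hb))).1 (State.mem_edges_map.2 hb)

/-- An apex lies outside the edgeless base, and adding it contributes one point and at least `k`
edges of weight `α R`. As `k * α R > 1`, the predimension would drop below that of the base, against
strength. -/
theorem not_cone_of_strong_discrete (hα : ∀ R, 0 < α R) (R : L.Relations (l + 2))
    (hk : 1 < k * α ⟨l + 2, R⟩)
    (hs : (State.discrete α (Finset.range (k * (l + 1)))).Strong Set.univ G.edges) (c : ℕ) :
    ¬ ∀ j : Fin k, coneEdge R Fin.val c j ∈ G.edges := by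
  classical
  intro h
  have hk0 : 0 < k := Nat.pos_of_ne_zero fun h0 => by simp [h0] at hk; linarith
  have hsub : ∀ j : Fin k, (coneEdge R Fin.val c j).2 ⊆
      insert c (Finset.range (k * (l + 1))) := fun j n hn => by
    obtain ⟨i, -, rfl⟩ := Finset.mem_image.1 hn
    refine Fin.cases (Finset.mem_insert_self _ _) (fun i => Finset.mem_insert_of_mem ?_) i
    exact Finset.mem_range.2 (finProdFinEquiv (j, i)).2
  have hc : c ∉ Finset.range (k * (l + 1)) := fun hc => by
    have := (hs.mem_iff _ ((hsub ⟨0, hk0⟩).trans (Finset.insert_eq_of_mem hc).le)).2 (h ⟨0, hk0⟩)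
    simp [State.discrete] at this
  have hc' : ∀ i : Fin (k * (l + 1)), (i : ℕ) ≠ c := fun i hi =>
    hc (Finset.mem_range.2 (hi ▸ i.2))
  have hle := hs.le_predim (insert c (Finset.range (k * (l + 1)))) (Set.subset_univ _)
  have hi : insert c (Finset.range (k * (l + 1))) ∩
      (State.discrete α (Finset.range (k * (l + 1)))).verts = Finset.range (k * (l + 1)) :=
    Finset.inter_eq_right.2 (Finset.subset_insert _ _)
  have h0 : predim α G.edges (Finset.range (k * (l + 1))) = (k * (l + 1) : ℕ) := by
    rw [← predim_congr (X := Finset.range (k * (l + 1)))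
      (E := (State.discrete α (Finset.range (k * (l + 1)))).edges) fun e he => hs.mem_iff e he]
    simp [State.discrete, predim, edgesIn]
  have hsum : ∑ j : Fin k, α ⟨l + 2, R⟩ ≤
      ∑ e ∈ edgesIn G.edges (insert c (Finset.range (k * (l + 1)))), α e.1 := by
    let φ : Fin k → Edge L ℕ := coneEdge R Fin.val c
    have hφ : Function.Injective φ := fun j j' hj =>
      image_coneTuple_injective Fin.val_injective hc' (congrArg Prod.snd hj)
    rw [← Finset.sum_image (s := Finset.univ) (g := φ) (f := fun e => α e.1) hφ.injOn]
    refine Finset.sum_le_sum_of_subset_of_nonneg (fun e he => ?_) fun e _ _ => (hα _).le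
    obtain ⟨j, -, rfl⟩ := Finset.mem_image.1 he
    exact mem_edgesIn.2 ⟨h j, hsub j⟩
  rw [hi, h0, predim, Finset.card_insert_of_notMem hc, Finset.card_range] at hle
  simp only [Finset.sum_const, Finset.card_univ, Fintype.card_fin, nsmul_eq_mul] at hsum
  push_cast at hle
  linarith

end GenericSequence

end Cone

end KAlpha

/-! ### The non-elementary self-embedding. -/

theorem mainTheorem8 (L : FirstOrder.Language.{0, 0}) [L.IsRelational]
    [Fintype (Σ n, L.Relations n)] (α : (Σ n, L.Relations n) → ℝ)
    (hα : ∀ R, 0 < α R ∧ α R ≤ 1) (hL : ∃ R : (Σ n, L.Relations n), 2 ≤ R.1) :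
    ¬ KAlpha.IsModelComplete (KAlpha.genericTheory α) := by
  classical
  intro hmc
  obtain ⟨⟨n, R⟩, hn⟩ := hL
  obtain ⟨l, rfl⟩ : ∃ l, n = l + 2 := ⟨n - 2, by simp only at hn; omega⟩
  obtain ⟨k, hk⟩ : ∃ k : ℕ, 1 < k * α ⟨l + 2, R⟩ := by
    obtain ⟨k, hk⟩ := exists_nat_gt (1 / α ⟨l + 2, R⟩)
    exact ⟨k, (div_lt_iff₀ (hα _).1).1 hk⟩
  have hpos : ∀ R, 0 < α R := fun R => (hα R).1
  obtain ⟨G, hG⟩ := KAlpha.GenericSequence.exists_start hpos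
    (KAlpha.State.discrete α (Finset.range (k * (l + 1))))
  obtain ⟨ρ, hρ, hcone⟩ := G.exists_embeds_cone hα R k
  rw [← hG] at hρ
  -- `F` sends the strong edgeless base onto the base of a realized cone.
  obtain ⟨F, hF, hFe⟩ := hρ.extend_univ
  rw [hG] at hF
  let := KAlpha.structureOfEdges G.edges
  have hgen : KAlpha.IsGeneric α ℕ := G.isGeneric fun R => (hpos R).le
  have hsymm := G.inK.1
  have hmodel : (KAlpha.genericTheory α).Model ℕ := ⟨fun φ hφ => hφ ℕ hgen⟩
  let f : L.Embedding ℕ ℕ := KAlpha.embeddingOfEdges hsymm hsymm F fun R s => by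
    rw [G.edgeSet_eq]
    exact (hFe (R, s)).symm
  let M := FirstOrder.Language.Theory.ModelType.of (KAlpha.genericTheory α) ℕ
  have key : (KAlpha.coneFormula R k).Realize (f ∘ Fin.val) ↔
      (KAlpha.coneFormula R k).Realize (Fin.val : Fin (k * (l + 1)) → ℕ) :=
    hmc M M f _ (KAlpha.coneFormula R k) Fin.val
  rw [KAlpha.realize_coneFormula, KAlpha.realize_coneFormula] at key
  have hstrong := G.strong_seq 0
  rw [hG] at hstrong
  -- The image tuple has the apex `ρ (k * (l + 1))`; elementarity would pull an apex back to the
  -- strong base.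
  obtain ⟨c, hc⟩ := key.1 ⟨ρ (k * (l + 1)), fun j => by
    have hFρ : f ∘ (Fin.val : Fin (k * (l + 1)) → ℕ) = ρ ∘ Fin.val :=
      funext fun i => hF i (Finset.mem_range.2 i.2)
    have hinj : Function.Injective (ρ ∘ KAlpha.coneTuple Fin.val (k * (l + 1)) j) :=
      ρ.injective.comp
        (KAlpha.coneTuple_injective Fin.val_injective KAlpha.val_ne_card j)
    rw [KAlpha.comp_coneTuple] at hinj
    rw [hFρ]
    exact ⟨hinj, hcone j⟩⟩
  exact G.not_cone_of_strong_discrete hpos R hk hstrong c fun j => (hc j).2
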